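/- Let $\Gamma=(V,(\gamma_{ij}))$ be a finite weighted graph: $\gamma_{ij}=\gamma_{ji}\in\mathbb R$, $\gamma_{ii}=0$, and $i,j$ are joined by an edge of weight $\gamma_{ij}$ iff $\gamma_{ij}\neq0$. Edges of negative weight are called red and are enumerated as $e_1,\dots,e_R$; edges of positive weight are called black. For $b\in\{0,1\}^R$ let $$A_b=\sum_T\ \prod_{\substack{\{i,j\}\in T\\ \gamma_{ij}>0}}\gamma_{ij},$$ the sum being over the spanning trees $T$ of $\Gamma$ whose red edges are exactly the $e_k$ with $b_k=1$. Let $\tilde b$ be a wildcard, that is, a binary sequence of length $R$ in which the digits at two positions $p<q$ are replaced by wildcard symbols. Writing $\tilde b(\alpha\beta)$ for the binary sequence obtained by putting $\alpha$ in position $p$ and $\beta$ in position $q$, the reduced discriminant is $$\Delta_{\tilde b}=A_{\tilde b(11)}A_{\tilde b(00)}-A_{\tilde b(01)}A_{\tilde b(10)} .$$ Suppose that the red edges with digit $1$ in $\tilde b$ contain no cycle. Let $\Gamma_{\tilde b}$ be the multigraph obtained from $\Gamma$ by deleting the red edges with digit $0$ and contracting the red edges with digit $1$ (all other edges keep their weights,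 and resulting parallel edges and loops are kept). Let $u_0,u_1$ be the endpoints of $e_p$ and $v_0,v_1$ the endpoints of $e_q$ in $\Gamma_{\tilde b}$, each pair in an arbitrary order. Let $F^{(2)}$ be the set of spanning 2-forests of $\Gamma_{\tilde b}$ (acyclic spanning subgraphs with exactly two connected components) in which each of the two trees contains exactly one element of the set $U=\{u_0,u_1\}$ and exactly one element of the set $W=\{v_0,v_1\}$. For $F\in F^{(2)}$ let $n(F)=0$ if $u_0$ and $v_0$ lie in the same tree of $F$ and $n(F)=1$ otherwise, and let $\pi(F)$ be the product of the weights of the edges of $F$. Then $$\Delta_{\tilde b}=-\Bigl(\sum_{F\in F^{(2)}}(-1)^{n(F)}\,\pi(F)\Bigr)^2 .$$ In particular, if all black edges have weight $1$, then $\Delta_{\tilde b}=-\bigl(\sum_{F\in F^{(2)}}(-1)^{n(F)}\bigr)^2$ is minus the square of a signed count of spanning 2-forests. If the red edges with digit $1$ in $\tilde b$ contain a cycle, then $\Delta_{\tilde b}=0$. -/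

import Mathlib

/-! ### Multigraphs: connectivity, forests, contraction -/

namespace Graph

variable {α β : Type*}

/-- `x` and `y` are joined by a walk of `G`. -/
def Linked (G : Graph α β) (x y : α) : Prop := Relation.ReflTransGen G.Adj x y

theorem linked_equivalence (G : Graph α β) : Equivalence G.Linked where
  refl _ := Relation.ReflTransGen.refl
  symm h := by
    induction h with
    | refl => exact Relation.ReflTransGen.refl
    | tail _ h ih => exact Relation.ReflTransGen.head h.symm ih
  trans h h' := Relation.ReflTransGen.trans h h'

/-- The equivalence relation of being joined by a walk. -/
def linkedSetoid (G : Graph α β) : Setoid α := ⟨G.Linked, G.linked_equivalence⟩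

/-- The set of connected components of `G`. -/
def components (G : Graph α β) : Set (Quotient G.linkedSetoid) :=
  Quotient.mk G.linkedSetoid '' V(G)

/-- `G` has no cycle: no edge `e` can be closed up to a cycle by a walk which avoids `e`.
In particular there are no loops and no parallel edges. -/
def IsAcyclic (G : Graph α β) : Prop :=
  ∀ e x y, G.IsLink e x y → ¬ (G.deleteEdges {e}).Linked x y

/-- `F` is the edge set of a spanning `k`-forest of `G`: the spanning subgraph with edge set `F`
is acyclic and has exactly `k` connected components. -/
def IsSpanningForest (G : Graph α β) (k : ℕ) (F : Finset β) : Prop :=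
  (F : Set β) ⊆ E(G) ∧ (G.restrict F).IsAcyclic ∧ (G.restrict F).components.encard = k

/-- A spanning tree is a spanning `1`-forest. -/
def IsSpanningTree (G : Graph α β) (F : Finset β) : Prop := G.IsSpanningForest 1 F

/-- Spanning `k`-forests of `G` in which every tree contains exactly one vertex of `U` and exactly
one vertex of `W`. -/
def IsSeparatingForest (G : Graph α β) (k : ℕ) (U W : Set α) (F : Finset β) : Prop :=
  G.IsSpanningForest k F ∧
    ∀ c ∈ (G.restrict F).components,
      (∃! u, u ∈ U ∧ Quotient.mk (G.restrict F).linkedSetoid u = c) ∧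
      (∃! v, v ∈ W ∧ Quotient.mk (G.restrict F).linkedSetoid v = c)

open Classical in
/-- The finite set of these forests. -/
noncomputable def separatingForests [Fintype β] (G : Graph α β) (k : ℕ) (U W : Set α) :
    Finset (Finset β) :=
  Finset.univ.filter fun F => G.IsSeparatingForest k U W F

open Classical in
/-- The sign exponent of a spanning `2`-forest `F`, relative to the first vertices `u` and `v` of
enumerations of two two-element sets `U` and `W`: it is `0` if `u` and `v` lie in the same tree of
`F` and `1` otherwise. So `(-1) ^ signExponent` is the sign of the bijection `W → U` which matches
the vertices that lie in the same tree. -/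
noncomputable def signExponent (G : Graph α β) (u v : α) (F : Finset β) : ℕ :=
  if (G.restrict F).Linked u v then 0 else 1

/-- Contraction of a set `C` of edges: the vertices joined by edges of `C` are identified, the
edges of `C` disappear, all others (also those that become parallel, or loops) are kept. -/
def contract (G : Graph α β) (C : Set β) :
    Graph (Quotient (G.restrict C).linkedSetoid) β :=
  (G.deleteEdges C).map (Quotient.mk (G.restrict C).linkedSetoid)

end Graph

/-! ### Weighted graphs and the reduced discriminants -/

/-- A weighted graph on `V`: symmetric real weights `γ i j`, where `γ i j ≠ 0` means that `i` and
`j` are joined by an edge of that weight. -/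
structure WeightedGraph (V : Type*) where
  weight : V → V → ℝ
  symm : ∀ i j, weight i j = weight j i
  loopless : ∀ i, weight i i = 0

/-- A wildcard of length `R`: a binary sequence in which the digits at two positions
`fst < snd` are replaced by wildcard symbols. -/
structure Wildcard (R : ℕ) where
  fst : Fin R
  snd : Fin R
  lt : fst < snd
  digit : {k : Fin R // k ≠ fst ∧ k ≠ snd} → Bool

/-- The binary sequence obtained by writing `a` and `b` for the first and the second wildcard
symbol. -/
def Wildcard.fill {R : ℕ} (w : Wildcard R) (a b : Bool) (k : Fin R) : Bool :=
  if h₁ : k = w.fst then a else if h₂ : k = w.snd then b else w.digit ⟨k, h₁, h₂⟩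

namespace WeightedGraph

variable {V : Type*}

/-- The weight of an unordered pair of vertices. -/
def edgeWeight (Γ : WeightedGraph V) : Sym2 V → ℝ := Sym2.lift ⟨Γ.weight, Γ.symm⟩

/-- The underlying simple graph. -/
def toSimpleGraph (Γ : WeightedGraph V) : SimpleGraph V where
  Adj i j := Γ.weight i j ≠ 0
  symm := ⟨fun i j h => by rwa [Γ.symm j i]⟩
  loopless := ⟨fun i h => h (Γ.loopless i)⟩

/-- The underlying graph as a multigraph; its edges are labelled by unordered pairs of vertices. -/
def toGraph (Γ : WeightedGraph V) : Graph V (Sym2 V) := Graph.ofSimpleGraph Γ.toSimpleGraph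

/-- The red edges are those of negative weight; the black ones have positive weight. -/
def RedEdge (Γ : WeightedGraph V) : Type _ := {x : Sym2 V // Γ.edgeWeight x < 0}

variable {R : ℕ}

open Classical in
/-- The coefficient `A_b`: the sum, over all spanning trees whose red edges are exactly
those with digit `1` in `b`, of the product of the weights of the black edges of the tree. -/
noncomputable def coeff [Fintype V] (Γ : WeightedGraph V) (e : Fin R ≃ Γ.RedEdge)
    (b : Fin R → Bool) : ℝ :=
  ∑ T : Finset (Sym2 V) with
      Γ.toGraph.IsSpanningTree T ∧ ∀ k, (e k).1 ∈ T ↔ b k = true,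
    ∏ x ∈ T with 0 < Γ.edgeWeight x, Γ.edgeWeight x

/-- The reduced discriminant of a wildcard. -/
noncomputable def discr [Fintype V] (Γ : WeightedGraph V) (e : Fin R ≃ Γ.RedEdge)
    (w : Wildcard R) : ℝ :=
  Γ.coeff e (w.fill true true) * Γ.coeff e (w.fill false false)
    - Γ.coeff e (w.fill false true) * Γ.coeff e (w.fill true false)

/-- The red edges whose digit in the wildcard `w` is `d`. -/
def digitEdges (Γ : WeightedGraph V) (e : Fin R ≃ Γ.RedEdge) (w : Wildcard R) (d : Bool) :
    Set (Sym2 V) :=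
  {x | ∃ k, w.digit k = d ∧ (e k.1).1 = x}

/-- The derived multigraph: the red edges with digit `0` are deleted, then those with digit `1`
are contracted. -/
def derived (Γ : WeightedGraph V) (e : Fin R ≃ Γ.RedEdge) (w : Wildcard R) :
    Graph (Quotient ((Γ.toGraph.deleteEdges (Γ.digitEdges e w false)).restrict
      (Γ.digitEdges e w true)).linkedSetoid) (Sym2 V) :=
  (Γ.toGraph.deleteEdges (Γ.digitEdges e w false)).contract (Γ.digitEdges e w true)

end WeightedGraph

/-! ### Walks, forests and contraction in multigraphs -/

namespace Graph

variable {α β : Type*} {G : Graph α β}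

/-! The spanning trees counted by the four coefficients contain every digit-1 red edge and no
digit-0 red edge. If the digit-1 edges contain a cycle, there are none. Otherwise, removing the
digit-1 edges turns these trees into the spanning trees of the derived multigraph. The coefficients
become sums T_{bc} over its trees, sorted by whether they contain p and q, with p and q counted with
weight 1 (`coeff_eq_spanningTreeSum`).

Let L be the reduced Laplacian of that multigraph with weight 0 on p and q, and let a, b be the
incidence columns of p, q. By the matrix-tree theorem (`det_reducedLaplacian`), det(L + x aaᵀ + y
bbᵀ) = T₀₀ + x T₁₀ + y T₀₁ + xy T₁₁. Hence the discriminant equals det(L + aaᵀ + bbᵀ) det L − det(L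
+ aaᵀ) det(L + bbᵀ). For invertible symmetric L this is −(det L · aᵀL⁻¹b)², and the number squared
is det(L + baᵀ) − det L, which makes sense for singular L too
(`det_mul_det_sub_det_mul_det_of_isSymm`).

Cauchy–Binet expands that difference into products of the minors of F ∪ {q} and F ∪ {p}, weighted by
π(F). An incidence minor is ±1 on spanning trees and 0 otherwise, so exactly the separating
2-forests survive (`isSeparatingForest_two_iff`). Modulo the columns of F, a is b up to the sign
(−1)^n(F), which is therefore the product of the two minors
(`det_updateCol_mul_det_incidenceMinor`). -/

theorem Linked.refl (x : α) : G.Linked x x := G.linked_equivalence.refl x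

theorem Linked.symm {x y : α} (h : G.Linked x y) : G.Linked y x := G.linked_equivalence.symm h

theorem Linked.trans {x y z : α} (h : G.Linked x y) (h' : G.Linked y z) : G.Linked x z :=
  G.linked_equivalence.trans h h'

theorem IsLink.linked {e : β} {x y : α} (h : G.IsLink e x y) : G.Linked x y :=
  Relation.ReflTransGen.single ⟨e, h⟩

theorem IsLink.linked_restrict {e : β} {x y : α} {F : Set β} (h : G.IsLink e x y) (he : e ∈ F) :
    (G.restrict F).Linked x y :=
  IsLink.linked (e := e) ⟨he, h⟩

/-- Being linked is the finest equivalence relation that relates the ends of every edge. -/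
theorem Linked.rel_of_isLink {x y : α} (h : G.Linked x y) (r : Setoid α)
    (hr : ∀ e a b, G.IsLink e a b → r a b) : r x y := by
  induction h with
  | refl => exact r.refl _
  | tail _ h ih =>
    obtain ⟨e, he⟩ := h
    exact r.trans ih (hr e _ _ he)

theorem Linked.restrict_mono {x y : α} {F F' : Set β} (h : (G.restrict F).Linked x y)
    (hF : F ⊆ F') : (G.restrict F').Linked x y :=
  h.rel_of_isLink (G.restrict F').linkedSetoid fun _ _ _ he => he.2.linked_restrict (hF he.1)

theorem restrict_deleteEdges (G : Graph α β) (F K : Set β) :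
    (G.restrict F).deleteEdges K = G.restrict (F \ K) := by
  ext a b c
  · simp
  · simp only [deleteEdges_isLink, restrict_isLink, Set.mem_sdiff]
    tauto

theorem isAcyclic_restrict_iff {F : Set β} :
    (G.restrict F).IsAcyclic ↔
      ∀ e ∈ F, ∀ x y, G.IsLink e x y → ¬ (G.restrict (F \ {e})).Linked x y := by
  simp only [IsAcyclic, restrict_deleteEdges, restrict_isLink]
  exact ⟨fun h e he x y hl => h e x y ⟨he, hl⟩, fun h e x y hl => h e hl.1 x y hl.2⟩

theorem IsAcyclic.restrict_mono {F F' : Set β} (h : (G.restrict F').IsAcyclic) (hF : F ⊆ F') :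
    (G.restrict F).IsAcyclic := by
  rw [isAcyclic_restrict_iff] at h ⊢
  exact fun e he x y hl hc => h e (hF he) x y hl (hc.restrict_mono (Set.sdiff_subset_sdiff_left hF))

/-- A walk can be shortened until it crosses `e` at most once, in one of the two directions. -/
theorem Linked.of_insert {e : β} {x y a b : α} {K : Set β} (he : G.IsLink e x y)
    (h : (G.restrict (insert e K)).Linked a b) :
    (G.restrict K).Linked a b ∨
      ((G.restrict K).Linked a x ∧ (G.restrict K).Linked y b) ∨
      ((G.restrict K).Linked a y ∧ (G.restrict K).Linked x b) := by
  induction h with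
  | refl => exact Or.inl (Linked.refl _)
  | @tail b c _ h ih =>
    obtain ⟨f, hf, hl⟩ := h
    rcases Set.mem_insert_iff.1 hf with rfl | hf
    · obtain ⟨rfl, rfl⟩ | ⟨rfl, rfl⟩ := he.eq_and_eq_or_eq_and_eq hl
      · rcases ih with h | h | h
        · exact Or.inr (Or.inl ⟨h, Linked.refl _⟩)
        · exact Or.inr (Or.inl ⟨h.1, Linked.refl _⟩)
        · exact Or.inl h.1
      · rcases ih with h | h | h
        · exact Or.inr (Or.inr ⟨h, Linked.refl _⟩)
        · exact Or.inl h.1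
        · exact Or.inr (Or.inr ⟨h.1, Linked.refl _⟩)
    · have hbc := hl.linked_restrict hf
      rcases ih with h | h | h
      · exact Or.inl (h.trans hbc)
      · exact Or.inr (Or.inl ⟨h.1, h.2.trans hbc⟩)
      · exact Or.inr (Or.inr ⟨h.1, h.2.trans hbc⟩)

/-- An edge that joins two components of a forest can be added to it. -/
theorem IsAcyclic.insert {e : β} {x y : α} {F : Set β} (h : (G.restrict F).IsAcyclic)
    (he : G.IsLink e x y) (hxy : ¬ (G.restrict F).Linked x y) :
    (G.restrict (insert e F)).IsAcyclic := by
  by_cases heF : e ∈ F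
  · rwa [Set.insert_eq_of_mem heF]
  rw [isAcyclic_restrict_iff] at h ⊢
  intro f hf a b hl hc
  rcases Set.mem_insert_iff.1 hf with rfl | hfF
  · rw [Set.insert_sdiff_of_mem _ (Set.mem_singleton f), Set.sdiff_singleton_eq_self heF] at hc
    obtain ⟨rfl, rfl⟩ | ⟨rfl, rfl⟩ := he.eq_and_eq_or_eq_and_eq hl
    exacts [hxy hc, hxy hc.symm]
  · have hne : e ≠ f := fun h => heF (h ▸ hfF)
    rw [Set.insert_sdiff_of_notMem _ (by simpa using hne)] at hc
    have hm : F \ {f} ⊆ F := Set.sdiff_subset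
    have hab := hl.linked_restrict hfF
    rcases hc.of_insert he with hc | hc | hc
    · exact h f hfF a b hl hc
    · exact hxy ((hc.1.restrict_mono hm).symm.trans (hab.trans (hc.2.restrict_mono hm).symm))
    · exact hxy ((hc.2.restrict_mono hm).trans (hab.symm.trans (hc.1.restrict_mono hm)))

theorem linked_iff_mk_eq {x y : α} :
    G.Linked x y ↔ Quotient.mk G.linkedSetoid x = Quotient.mk G.linkedSetoid y :=
  (Quotient.eq (r := G.linkedSetoid)).symm

theorem isSpanningTree_iff [Nonempty α] (hV : V(G) = Set.univ) {F : Finset β} :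
    G.IsSpanningTree F ↔ (F : Set β) ⊆ E(G) ∧ (G.restrict F).IsAcyclic ∧
      ∀ x y, (G.restrict F).Linked x y := by
  have hc : (G.restrict (F : Set β)).components = Set.univ := by
    simp [components, hV]
  simp only [IsSpanningTree, IsSpanningForest, hc, Nat.cast_one]
  refine and_congr_right fun _ => and_congr_right fun _ => ?_
  rw [Set.encard_eq_one]
  constructor
  · rintro ⟨c, hc⟩ x y
    have h : ∀ d : Quotient (G.restrict (F : Set β)).linkedSetoid, d = c := fun d => by
      have : d ∈ Set.univ := Set.mem_univ d
      rw [hc] at this; exact this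
    exact linked_iff_mk_eq.2 ((h _).trans (h _).symm)
  · intro h
    obtain ⟨x⟩ := ‹Nonempty α›
    refine ⟨Quotient.mk _ x, Set.eq_singleton_iff_unique_mem.2 ⟨Set.mem_univ _, fun d _ => ?_⟩⟩
    induction d using Quotient.ind with
    | _ y => exact linked_iff_mk_eq.1 (h y x)

theorem IsSpanningTree.not_linked_of_insert [DecidableEq β] [Nonempty α] (hV : V(G) = Set.univ)
    {p : β} {x y : α} {F : Finset β} (h : G.IsSpanningTree (insert p F)) (hp : G.IsLink p x y)
    (hpF : p ∉ F) : ¬ (G.restrict (F : Set β)).Linked x y := by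
  rw [isSpanningTree_iff hV, Finset.coe_insert] at h
  have := (isAcyclic_restrict_iff.1 h.2.1) p (Set.mem_insert _ _) _ _ hp
  rwa [Set.insert_sdiff_of_mem _ (Set.mem_singleton p),
    Set.sdiff_singleton_eq_self (by simpa using hpF)] at this

theorem IsSpanningTree.linked_or_linked_of_insert [DecidableEq β] [Nonempty α]
    (hV : V(G) = Set.univ) {p : β} {x y : α} {F : Finset β} (h : G.IsSpanningTree (insert p F))
    (hp : G.IsLink p x y) (z : α) :
    (G.restrict (F : Set β)).Linked z x ∨ (G.restrict (F : Set β)).Linked z y := by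
  rw [isSpanningTree_iff hV, Finset.coe_insert] at h
  rcases (h.2.2 z x).of_insert hp with h | h | h
  exacts [Or.inl h, Or.inl h.1, Or.inr h.1]

/-- A spanning `2`-forest separates the ends of each of two edges if and only if it can be
completed to a spanning tree by either of them. -/
theorem isSeparatingForest_two_iff [DecidableEq β] (hV : V(G) = Set.univ) {p q : β} {u₀ u₁ v₀ v₁ : α}
    (hp : G.IsLink p u₀ u₁) (hq : G.IsLink q v₀ v₁) {F : Finset β} :
    G.IsSeparatingForest 2 {u₀, u₁} {v₀, v₁} F ↔
      p ∉ F ∧ q ∉ F ∧ G.IsSpanningTree (insert p F) ∧ G.IsSpanningTree (insert q F) := by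
  have : Nonempty α := ⟨u₀⟩
  have hc : (G.restrict (F : Set β)).components = Set.univ := by
    simp [components, hV]
  have tree : ∀ {p : β} {u₀ u₁ : α}, G.IsLink p u₀ u₁ → G.IsSpanningForest 2 F →
      (∀ c : Quotient (G.restrict (F : Set β)).linkedSetoid,
        ∃! u, u ∈ ({u₀, u₁} : Set α) ∧ Quotient.mk _ u = c) →
      p ∉ F ∧ G.IsSpanningTree (insert p F) := by
    intro p u₀ u₁ hp hF h
    have hex : ∀ z, (G.restrict (F : Set β)).Linked z u₀ ∨ (G.restrict (F : Set β)).Linked z u₁ := by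
      intro z
      obtain ⟨u, ⟨hu | hu, hc⟩, -⟩ := h (Quotient.mk _ z)
      · subst hu; exact Or.inl (linked_iff_mk_eq.2 hc.symm)
      · cases hu; exact Or.inr (linked_iff_mk_eq.2 hc.symm)
    -- If the ends were linked, there would be a single component. This also rules out a loop, where
    -- `u₀ = u₁`.
    have hn : ¬ (G.restrict (F : Set β)).Linked u₀ u₁ := by
      intro hl
      have h2 := hF.2.2
      rw [hc, show (((2 : ℕ) : ℕ∞)) = 2 from rfl, Set.encard_eq_two] at h2
      obtain ⟨c, d, hcd, -⟩ := h2
      have key : ∀ e : Quotient (G.restrict (F : Set β)).linkedSetoid, e = Quotient.mk _ u₀ := by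
        intro e
        induction e using Quotient.ind with
        | _ z =>
          rcases hex z with hz | hz
          · exact linked_iff_mk_eq.1 hz
          · exact linked_iff_mk_eq.1 (hz.trans hl.symm)
      exact hcd ((key c).trans (key d).symm)
    have hpF : p ∉ F := fun hpF => hn (hp.linked_restrict hpF)
    refine ⟨hpF, (isSpanningTree_iff hV).2 ⟨?_, ?_, ?_⟩⟩
    · rw [Finset.coe_insert]
      exact Set.insert_subset hp.edge_mem hF.1
    · rw [Finset.coe_insert]
      exact hF.2.1.insert hp hn
    · rw [Finset.coe_insert]
      have hz : ∀ z, (G.restrict (insert p (F : Set β))).Linked z u₀ := by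
        intro z
        rcases hex z with hz | hz
        · exact hz.restrict_mono (Set.subset_insert _ _)
        · exact (hz.restrict_mono (Set.subset_insert _ _)).trans
            (hp.symm.linked_restrict (Set.mem_insert _ _))
      exact fun x y => (hz x).trans (hz y).symm
  have sep : ∀ {p : β} {u₀ u₁ : α}, G.IsLink p u₀ u₁ → p ∉ F → G.IsSpanningTree (insert p F) →
      G.IsSpanningForest 2 F ∧ (∀ c : Quotient (G.restrict (F : Set β)).linkedSetoid,
        ∃! u, u ∈ ({u₀, u₁} : Set α) ∧ Quotient.mk _ u = c) := by
    intro p u₀ u₁ hp hpF h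
    have hn := h.not_linked_of_insert hV hp hpF
    have hex := h.linked_or_linked_of_insert hV hp
    rw [isSpanningTree_iff hV, Finset.coe_insert] at h
    obtain ⟨hE, hA, -⟩ := h
    have hne : Quotient.mk (G.restrict (F : Set β)).linkedSetoid u₀ ≠ Quotient.mk _ u₁ :=
      fun h => hn (linked_iff_mk_eq.2 h)
    have hcc : ∀ c : Quotient (G.restrict (F : Set β)).linkedSetoid,
        c = Quotient.mk _ u₀ ∨ c = Quotient.mk _ u₁ := by
      intro c
      induction c using Quotient.ind with
      | _ z => exact (hex z).imp linked_iff_mk_eq.1 linked_iff_mk_eq.1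
    refine ⟨⟨(Set.subset_insert _ _).trans hE, hA.restrict_mono (Set.subset_insert _ _), ?_⟩, ?_⟩
    · rw [hc, show (((2 : ℕ) : ℕ∞)) = 2 from rfl, Set.encard_eq_two]
      exact ⟨_, _, hne, (Set.eq_univ_of_forall fun c => by simpa using hcc c).symm⟩
    · intro c
      rcases hcc c with rfl | rfl
      · refine ⟨u₀, ⟨by simp, rfl⟩, ?_⟩
        rintro y ⟨hy | hy, h⟩
        · exact hy
        · cases hy; exact absurd h.symm hne
      · refine ⟨u₁, ⟨by simp, rfl⟩, ?_⟩
        rintro y ⟨hy | hy, h⟩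
        · subst hy; exact absurd h hne
        · exact hy
  constructor
  · rintro ⟨hF, h⟩
    rw [hc] at h
    obtain ⟨h1, h2⟩ := tree hp hF fun c => (h c (Set.mem_univ c)).1
    obtain ⟨h3, h4⟩ := tree hq hF fun c => (h c (Set.mem_univ c)).2
    exact ⟨h1, h3, h2, h4⟩
  · rintro ⟨h1, h3, h2, h4⟩
    exact ⟨(sep hp h1 h2).1, fun c _ => ⟨(sep hp h1 h2).2 c, (sep hq h3 h4).2 c⟩⟩

/-- Both sides are generated by their edges, so it suffices to compare single edges; those of `C`
become equalities in the quotient. -/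
theorem linked_contract_restrict_iff {C S : Set β} {x y : α} :
    ((G.contract C).restrict S).Linked (Quotient.mk _ x) (Quotient.mk _ y) ↔
      (G.restrict (C ∪ S)).Linked x y := by
  constructor
  · intro h
    have hle : ∀ a b, (G.restrict C).linkedSetoid a b → (G.restrict (C ∪ S)).linkedSetoid a b :=
      fun a b hab => Linked.restrict_mono hab Set.subset_union_left
    let f : Quotient (G.restrict C).linkedSetoid → Quotient (G.restrict (C ∪ S)).linkedSetoid :=
      Quotient.map' id hle
    refine linked_iff_mk_eq.2 (h.rel_of_isLink (Setoid.ker f) ?_)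
    rintro e _ _ ⟨he, a, b, ⟨hab, -⟩, rfl, rfl⟩
    exact linked_iff_mk_eq.1 (hab.linked_restrict (Or.inr he))
  · intro h
    refine h.rel_of_isLink (((G.contract C).restrict S).linkedSetoid.comap (Quotient.mk _)) ?_
    rintro e a b ⟨he, hab⟩
    change ((G.contract C).restrict S).Linked _ _
    by_cases heC : e ∈ C
    · rw [linked_iff_mk_eq.1 (hab.linked_restrict heC)]
      exact Linked.refl _
    · exact IsLink.linked_restrict (e := e) ⟨a, b, ⟨hab, heC⟩, rfl, rfl⟩
        (he.resolve_left heC)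

/-- From left to right, the edges of `S` are added to `C` one at a time: one that closed a cycle
would have its ends linked in the contraction by other edges of `S`. -/
theorem isAcyclic_contract_restrict_iff {C S : Set β} (hS : Disjoint S C) (hfin : S.Finite)
    (hC : (G.restrict C).IsAcyclic) :
    ((G.contract C).restrict S).IsAcyclic ↔ (G.restrict (C ∪ S)).IsAcyclic := by
  have hdiff : ∀ e ∈ S, (C ∪ S) \ {e} = C ∪ (S \ {e}) := fun e he => by
    rw [Set.union_sdiff_distrib, Set.sdiff_singleton_eq_self (Set.disjoint_left.1 hS he)]
  constructor
  · intro h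
    rw [isAcyclic_restrict_iff] at h
    have key : ∀ K : Set β, K.Finite → K ⊆ S → (G.restrict (C ∪ K)).IsAcyclic := by
      intro K hK
      induction K, hK using Set.Finite.induction_on with
      | empty => intro _; rwa [Set.union_empty]
      | @insert e K heK _ ih =>
        intro hKS
        have heS : e ∈ S := hKS (Set.mem_insert _ _)
        have hA := ih ((Set.subset_insert _ _).trans hKS)
        rw [Set.union_insert]
        by_cases heE : e ∈ E(G)
        · obtain ⟨x, y, hxy⟩ := exists_isLink_of_mem_edgeSet heE
          refine hA.insert hxy fun hl => ?_
          refine h e heS _ _ ⟨x, y, ⟨hxy, Set.disjoint_left.1 hS heS⟩, rfl, rfl⟩ ?_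
          rw [linked_contract_restrict_iff]
          exact hl.restrict_mono (Set.union_subset_union_right _
            (Set.subset_sdiff_singleton ((Set.subset_insert _ _).trans hKS) heK))
        -- Elements of `S` that are not edges of `G` do not change the restriction.
        · rw [← restrict_edgeSet_inter, Set.inter_insert_of_notMem heE, restrict_edgeSet_inter]
          exact hA
    exact key S hfin subset_rfl
  · intro h
    rw [isAcyclic_restrict_iff] at h ⊢
    rintro e he _ _ ⟨x, y, ⟨hxy, -⟩, rfl, rfl⟩
    rw [linked_contract_restrict_iff, ← hdiff e he]
    exact h e (Or.inr he) x y hxy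

theorem vertexSet_contract (hV : V(G) = Set.univ) (C : Set β) :
    V(G.contract C) = Set.univ := by
  simp [contract, hV]

theorem isSpanningTree_contract_iff [DecidableEq β] [Nonempty α] (hV : V(G) = Set.univ) {C S : Finset β}
    (hS : Disjoint S C) (hCE : (C : Set β) ⊆ E(G)) (hC : (G.restrict (C : Set β)).IsAcyclic) :
    (G.contract (C : Set β)).IsSpanningTree S ↔ G.IsSpanningTree (C ∪ S) := by
  have : Nonempty (Quotient (G.restrict (C : Set β)).linkedSetoid) := ⟨Quotient.mk _ (Classical.arbitrary α)⟩
  have hS' : Disjoint (S : Set β) C := by exact_mod_cast hS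
  rw [isSpanningTree_iff (vertexSet_contract hV _), isSpanningTree_iff hV, Finset.coe_union,
    isAcyclic_contract_restrict_iff hS' S.finite_toSet hC]
  refine and_congr ?_ (and_congr_right fun _ => ?_)
  · change (S : Set β) ⊆ E(G) \ C ↔ _
    rw [Set.subset_sdiff, Set.union_subset_iff]
    tauto
  · rw [(Quotient.mk_surjective (s := (G.restrict (C : Set β)).linkedSetoid)).forall₂]
    exact forall₂_congr fun _ _ => linked_contract_restrict_iff

end Graph

/-! ### Cauchy–Binet and rank-one updates of determinants -/

namespace Matrix

section CauchyBinet

variable {ι β R : Type*} [Fintype ι] [DecidableEq ι] [Fintype β] [CommRing R]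

/-- Each row of the product is a combination of rows of `B`; expand by multilinearity. -/
theorem det_mul_eq_sum_prod_mul_det (A : Matrix ι β R) (B : Matrix β ι R) :
    (A * B).det = ∑ f : ι → β, (∏ i, A i (f i)) * (B.submatrix f id).det := by
  have h : A * B = fun i => ∑ e, A i e • B e := by
    funext i j
    simp [mul_apply, Finset.sum_apply]
  have h2 := (detRowAlternating (n := ι) (R := R)).toMultilinearMap.map_sum
    (g := fun i e => A i e • B e)
  change det _ = _ at h2
  rw [h, h2]
  refine Finset.sum_congr rfl fun f _ => ?_
  exact (detRowAlternating (n := ι) (R := R)).toMultilinearMap.map_smul_univ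
    (fun i => A i (f i)) fun i => B (f i)

/-- Permuting the rows of `A` and correcting by the sign leaves the multilinear expansion unchanged,
and summing over all permutations assembles the minor of `A`. The factorial allows summing over all
`f`, with no ordering of `β` to choose. -/
theorem factorial_mul_det_mul (A : Matrix ι β R) (B : Matrix β ι R) :
    ((Fintype.card ι).factorial : R) * (A * B).det =
      ∑ f : ι → β, (A.submatrix id f).det * (B.submatrix f id).det := by
  have h : ∀ σ : Equiv.Perm ι, (Equiv.Perm.sign σ : R) *
      ∑ f : ι → β, (∏ i, A (σ i) (f i)) * (B.submatrix f id).det = (A * B).det := by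
    intro σ
    have := det_mul_eq_sum_prod_mul_det (A.submatrix σ id) B
    simp only [submatrix_apply, id] at this
    rw [← this, show A.submatrix σ id * B = (A * B).submatrix σ id from rfl, det_permute,
      ← mul_assoc, ← Int.cast_mul, ← Units.val_mul, Int.units_mul_self]
    simp
  calc ((Fintype.card ι).factorial : R) * (A * B).det
      = ∑ σ : Equiv.Perm ι, (Equiv.Perm.sign σ : R) *
          ∑ f : ι → β, (∏ i, A (σ i) (f i)) * (B.submatrix f id).det := by
        simp only [h, Finset.sum_const, Finset.card_univ, Fintype.card_perm, nsmul_eq_mul]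
    _ = _ := by
        simp only [Finset.mul_sum]
        rw [Finset.sum_comm]
        refine Finset.sum_congr rfl fun f _ => ?_
        rw [det_apply' (A.submatrix id f), Finset.sum_mul]
        refine Finset.sum_congr rfl fun σ _ => ?_
        simp [mul_assoc]

theorem card_injective_image_eq [DecidableEq β] {S : Finset β} (hS : S.card = Fintype.card ι) :
    (Finset.univ.filter fun f : ι → β =>
      Function.Injective f ∧ Finset.univ.image f = S).card = (Fintype.card ι).factorial := by
  have h : Fintype.card (ι ↪ S) = (Fintype.card ι).factorial := by
    rw [Fintype.card_embedding_eq, Fintype.card_coe, hS, Nat.descFactorial_self]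
  rw [← h, ← Finset.card_univ]
  symm
  refine Finset.card_bij (fun g _ i => (g i : β)) ?_ ?_ ?_
  · intro g _
    have hinj : Function.Injective fun i => (g i : β) :=
      Subtype.val_injective.comp g.injective
    refine Finset.mem_filter.2 ⟨Finset.mem_univ _, hinj, Finset.eq_of_subset_of_card_le ?_ ?_⟩
    · intro x hx
      obtain ⟨i, -, rfl⟩ := Finset.mem_image.1 hx
      exact (g i).2
    · rw [Finset.card_image_of_injective _ hinj, hS, Finset.card_univ]
  · intro g _ g' _ hgg
    ext i
    exact congrFun hgg i
  · intro f hf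
    obtain ⟨-, hinj, him⟩ := Finset.mem_filter.1 hf
    exact ⟨⟨fun i => ⟨f i, him ▸ Finset.mem_image_of_mem f (Finset.mem_univ i)⟩,
      fun i j hij => hinj (Subtype.ext_iff.1 hij)⟩, Finset.mem_univ _, rfl⟩

/-- The **Cauchy–Binet formula**, for a function `φ` which describes the products of the
complementary minors. -/
theorem det_mul_eq_sum_powersetCard [DecidableEq β] [IsDomain R] [CharZero R] (A : Matrix ι β R)
    (B : Matrix β ι R) (φ : Finset β → R)
    (h : ∀ f : ι → β, Function.Injective f →
      (A.submatrix id f).det * (B.submatrix f id).det = φ (Finset.univ.image f)) :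
    (A * B).det = ∑ S ∈ Finset.univ.powersetCard (Fintype.card ι), φ S := by
  have hfac : ((Fintype.card ι).factorial : R) ≠ 0 := by
    exact_mod_cast Nat.factorial_ne_zero _
  apply mul_left_cancel₀ hfac
  -- A non-injective `f` repeats a row of `B`. The injective ones are grouped by image, each image
  -- arising from `(card ι)!` functions.
  rw [factorial_mul_det_mul, ← Finset.sum_filter_of_ne (p := Function.Injective)]
  · rw [← Finset.sum_fiberwise_of_maps_to (g := fun f : ι → β => Finset.univ.image f)
      (t := Finset.univ.powersetCard (Fintype.card ι)), Finset.mul_sum]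
    · refine Finset.sum_congr rfl fun S hS => ?_
      rw [Finset.filter_filter, Finset.sum_congr rfl (g := fun _ => φ S), Finset.sum_const,
        card_injective_image_eq (Finset.mem_powersetCard.1 hS).2, nsmul_eq_mul]
      intro f hf
      obtain ⟨-, hinj, him⟩ := Finset.mem_filter.1 hf
      rw [h f hinj, him]
    · intro f hf
      rw [Finset.mem_powersetCard]
      exact ⟨Finset.subset_univ _, by
        rw [Finset.card_image_of_injective _ (Finset.mem_filter.1 hf).2, Finset.card_univ]⟩
  · intro f _ hne
    by_contra hinj
    obtain ⟨i, j, hij, hne'⟩ := Function.not_injective_iff.1 hinj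
    exact hne (by rw [det_zero_of_row_eq hne' (M := B.submatrix f id)
      (by ext k; simp [hij]), mul_zero])

end CauchyBinet

section RankOne

variable {n : Type*} [Fintype n] [DecidableEq n]

theorem det_add_vecMulVec_of_isUnit {R : Type*} [CommRing R] {A : Matrix n n R}
    (hA : IsUnit A.det) (u v : n → R) :
    (A + vecMulVec u v).det = A.det * (1 + v ⬝ᵥ (A⁻¹ *ᵥ u)) := by
  rw [vecMulVec_eq Unit, det_add_replicateCol_mul_replicateRow hA, det_unique (n := Unit), Matrix.mul_assoc]
  simp [replicateRow, replicateCol, mul_apply, dotProduct, mulVec]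

/-- The update is `A + UᵀU` for the two-row matrix `U` with rows `a`, `b`, which reduces the
determinant to a 2×2 one. -/
theorem det_add_vecMulVec_add_vecMulVec_of_isUnit {R : Type*} [CommRing R] {A : Matrix n n R}
    (hA : IsUnit A.det) (a b : n → R) :
    (A + vecMulVec a a + vecMulVec b b).det = A.det *
      ((1 + a ⬝ᵥ (A⁻¹ *ᵥ a)) * (1 + b ⬝ᵥ (A⁻¹ *ᵥ b)) -
        (a ⬝ᵥ (A⁻¹ *ᵥ b)) * (b ⬝ᵥ (A⁻¹ *ᵥ a))) := by
  have h : A + vecMulVec a a + vecMulVec b b = A + (of ![a, b])ᵀ * of ![a, b] := by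
    rw [add_assoc]
    congr 1
    ext i j
    simp [mul_apply, vecMulVec_apply, Fin.sum_univ_two]
  have hent : ∀ k l, (of ![a, b] * A⁻¹ * (of ![a, b])ᵀ) k l =
      (![a, b] k) ⬝ᵥ (A⁻¹ *ᵥ (![a, b] l)) := by
    intro k l
    rw [Matrix.mul_assoc]
    simp [mul_apply, dotProduct, mulVec]
  rw [h, det_add_mul _ _ hA, det_fin_two]
  simp only [add_apply, hent]
  simp

/-- The condensation identity for rank-one updates of a symmetric matrix. -/
theorem det_mul_det_sub_det_mul_det_of_isSymm {A : Matrix n n ℝ} (hA : A.IsSymm) (a b : n → ℝ) :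
    (A + vecMulVec a a + vecMulVec b b).det * A.det -
        (A + vecMulVec a a).det * (A + vecMulVec b b).det =
      -((A + vecMulVec b a).det - A.det) ^ 2 := by
  -- The shift by `t` is invertible for all but finitely many `t`; both sides are continuous in `t`,
  -- so the invertible case gives `t = 0`.
  let B : ℝ → Matrix n n ℝ := fun t => scalar n t + A
  have hB : Continuous B := by
    unfold B
    simp only [scalar_apply]
    fun_prop
  have hdense : Dense {t | (B t).det ≠ 0} := by
    have hfin : {t | (B t).det = 0}.Finite := by
      refine ((-A).charpoly.roots.toFinset.finite_toSet).subset fun t ht => ?_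
      have : (-A).charpoly ≠ 0 := (charpoly_monic (-A)).ne_zero
      simpa [this, Polynomial.IsRoot, eval_charpoly, B] using ht
    exact hfin.countable.dense_compl ℝ
  have key : (fun t => (B t + vecMulVec a a + vecMulVec b b).det * (B t).det -
        (B t + vecMulVec a a).det * (B t + vecMulVec b b).det) =
      fun t => -((B t + vecMulVec b a).det - (B t).det) ^ 2 := by
    refine Continuous.ext_on hdense ?_ ?_ ?_
    · have := fun M : Matrix n n ℝ => (hB.add (continuous_const (y := M))).matrix_det
      rw [show (fun t => (B t + vecMulVec a a + vecMulVec b b).det * (B t).det -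
        (B t + vecMulVec a a).det * (B t + vecMulVec b b).det) = fun t =>
        (B t + (vecMulVec a a + vecMulVec b b)).det * (B t).det -
        (B t + vecMulVec a a).det * (B t + vecMulVec b b).det by simp only [add_assoc]]
      exact ((this _).mul hB.matrix_det).sub ((this _).mul (this _))
    · have := fun M : Matrix n n ℝ => (hB.add (continuous_const (y := M))).matrix_det
      exact (((this _).sub hB.matrix_det).pow 2).neg
    · intro t ht
      have hu : IsUnit (B t).det := isUnit_iff_ne_zero.2 ht
      have hs : ((B t)⁻¹).IsSymm := by
        have : (B t).IsSymm := by
          simp only [B, IsSymm, transpose_add, hA.eq]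
          simp
        rw [IsSymm, transpose_nonsing_inv, this.eq]
      -- Symmetry makes the two off-diagonal entries equal; this is where the square comes from.
      have hsym : b ⬝ᵥ ((B t)⁻¹ *ᵥ a) = a ⬝ᵥ ((B t)⁻¹ *ᵥ b) := by
        rw [dotProduct_mulVec, ← mulVec_transpose, hs.eq, dotProduct_comm]
      simp only [det_add_vecMulVec_add_vecMulVec_of_isUnit hu, det_add_vecMulVec_of_isUnit hu, hsym]
      ring
  have := congrFun key 0
  simpa [B] using this

end RankOne

/-- A determinant vanishes if one column is replaced by a combination of the others. -/
theorem det_updateCol_eq_zero_of_mem_span {n R : Type*} [Fintype n] [DecidableEq n] [CommRing R]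
    (A : Matrix n n R) (i : n) {v : n → R}
    (hv : v ∈ Submodule.span R ((fun j => A.col j) '' {i}ᶜ)) : (A.updateCol i v).det = 0 := by
  rw [← cramer_apply]
  have h : Submodule.span R ((fun j => A.col j) '' {i}ᶜ) ≤
      LinearMap.ker ((LinearMap.proj i).comp (cramer A)) := by
    rw [Submodule.span_le]
    rintro _ ⟨j, hj, rfl⟩
    simp only [SetLike.mem_coe, LinearMap.mem_ker, LinearMap.comp_apply, LinearMap.proj_apply,
      cramer_apply]
    refine det_zero_of_column_eq (Ne.symm hj) fun k => ?_
    simp [show j ≠ i from hj]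
  exact h hv

end Matrix

/-! ### The reduced incidence matrix: spans, rank and minors -/

namespace Graph

section Incidence

variable {α β : Type*} [DecidableEq α] (R : Type*) [CommRing R]

/-- The indicator vector of the vertex `v`, with the coordinate of the root `r` left out. -/
def rootedIndicator (r v : α) : {v // v ≠ r} → R := fun i => if (i : α) = v then 1 else 0

/-- The column of the reduced incidence matrix that belongs to the edge `e` from `s e` to `t e`. -/
def incidence (r : α) (s t : β → α) (e : β) : {v // v ≠ r} → R :=
  rootedIndicator R r (s e) - rootedIndicator R r (t e)

@[simp]
theorem rootedIndicator_self (r : α) : rootedIndicator R r r = 0 := by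
  ext i
  simp [rootedIndicator, i.2]

theorem rootedIndicator_coe (r : α) (i : {v // v ≠ r}) :
    rootedIndicator R r i = Pi.single i 1 := by
  ext j
  simp [rootedIndicator, Pi.single_apply, Subtype.ext_iff]

variable {R} {G : Graph α β} {r : α} {s t : β → α}

/-- The edge columns along a walk telescope, up to sign. -/
theorem rootedIndicator_sub_mem_span (hst : ∀ e ∈ E(G), G.IsLink e (s e) (t e)) {F : Set β}
    {x y : α} (h : (G.restrict F).Linked x y) :
    rootedIndicator R r x - rootedIndicator R r y ∈
      Submodule.span R (incidence R r s t '' F) := by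
  let p := Submodule.span R (incidence R r s t '' F)
  have := h.rel_of_isLink (p.quotientRel.comap (rootedIndicator R r)) ?_
  · exact p.quotientRel_def.1 this
  · rintro e a b ⟨he, hab⟩
    refine p.quotientRel_def.2 ?_
    have hm : incidence R r s t e ∈ p := Submodule.subset_span ⟨e, he, rfl⟩
    obtain ⟨rfl, rfl⟩ | ⟨rfl, rfl⟩ := (hst e hab.edge_mem).eq_and_eq_or_eq_and_eq hab
    · exact hm
    · rw [← neg_sub]
      exact p.neg_mem hm

/-- The indicator function of the component of `x` defines a functional that kills every column of
`F`, but takes the value 1 on the difference if `y` lies in another component. -/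
theorem linked_of_rootedIndicator_sub_mem_span [Fintype α] [Nontrivial R]
    (hst : ∀ e ∈ E(G), G.IsLink e (s e) (t e)) {F : Set β} (hF : F ⊆ E(G)) {x y : α}
    (h : rootedIndicator R r x - rootedIndicator R r y ∈
      Submodule.span R (incidence R r s t '' F)) :
    (G.restrict F).Linked x y := by
  classical
  let f : α → R := fun v => if (G.restrict F).Linked x v then 1 else 0
  -- Subtracting `f r` compensates for the missing root coordinate, so that differences of
  -- indicators are evaluated correctly at the root too.
  let φ : ({v // v ≠ r} → R) →ₗ[R] R := Fintype.linearCombination R fun i => f i - f r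
  have hφ : ∀ v, φ (rootedIndicator R r v) = f v - f r := by
    intro v
    by_cases hv : v = r
    · subst hv
      simp
    · rw [show rootedIndicator R r v = Pi.single ⟨v, hv⟩ 1 from rootedIndicator_coe R r ⟨v, hv⟩]
      simp [φ]
  have hle : Submodule.span R (incidence R r s t '' F) ≤ LinearMap.ker φ := by
    rw [Submodule.span_le]
    rintro _ ⟨e, he, rfl⟩
    have hl := (hst e (hF he)).linked_restrict he
    have : f (s e) = f (t e) := by
      have : (G.restrict F).Linked x (s e) ↔ (G.restrict F).Linked x (t e) :=
        ⟨fun h => h.trans hl, fun h => h.trans hl.symm⟩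
      simp [f, this]
    simp [incidence, hφ, this]
  have h0 : φ (rootedIndicator R r x - rootedIndicator R r y) = 0 := hle h
  rw [map_sub, hφ, hφ, sub_sub_sub_cancel_right, sub_eq_zero] at h0
  by_contra hn
  simp [f, hn, Linked.refl] at h0

theorem span_incidence_eq_top [Fintype α] (hst : ∀ e ∈ E(G), G.IsLink e (s e) (t e))
    {F : Set β} (h : ∀ x y, (G.restrict F).Linked x y) :
    Submodule.span R (incidence R r s t '' F) = ⊤ := by
  rw [eq_top_iff, ← (Pi.basisFun R {v // v ≠ r}).span_eq, Submodule.span_le]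
  rintro _ ⟨i, rfl⟩
  have := rootedIndicator_sub_mem_span (R := R) (r := r) hst (h i r)
  simpa [rootedIndicator_coe] using this

theorem linearIndepOn_incidence [Fintype α] {K : Type*} [Field K]
    (hst : ∀ e ∈ E(G), G.IsLink e (s e) (t e)) {F : Set β} (hF : F ⊆ E(G))
    (h : (G.restrict F).IsAcyclic) : LinearIndepOn K (incidence K r s t) F := by
  rw [linearIndepOn_iff_notMem_span]
  intro e he hm
  exact isAcyclic_restrict_iff.1 h e he _ _ (hst e (hF he))
    (linked_of_rootedIndicator_sub_mem_span hst (Set.sdiff_subset.trans hF) hm)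

theorem card_le_of_linked [Fintype α] (hst : ∀ e ∈ E(G), G.IsLink e (s e) (t e)) (r : α)
    {F : Finset β} (h : ∀ x y, (G.restrict (F : Set β)).Linked x y) :
    Fintype.card {v // v ≠ r} ≤ F.card := by
  have h1 := span_incidence_eq_top (R := ℚ) (r := r) hst h
  have h2 := finrank_span_finset_le_card (R := ℚ) (M := {v // v ≠ r} → ℚ)
    (F.image (incidence ℚ r s t))
  rw [Set.finrank, Finset.coe_image, h1, finrank_top, Module.finrank_fintype_fun_eq_card] at h2
  exact h2.trans Finset.card_image_le

theorem IsSpanningTree.card_eq [Fintype α] (hst : ∀ e ∈ E(G), G.IsLink e (s e) (t e))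
    (hV : V(G) = Set.univ) (r : α) {F : Finset β} (h : G.IsSpanningTree F) :
    F.card = Fintype.card {v // v ≠ r} := by
  have : Nonempty α := ⟨r⟩
  obtain ⟨hE, hA, hL⟩ := (isSpanningTree_iff hV).1 h
  refine le_antisymm ?_ (card_le_of_linked hst r hL)
  have := (linearIndepOn_incidence (K := ℚ) (r := r) hst hE hA).fintype_card_le_finrank
  simpa using this

/-- Deleting an edge of a cycle would leave a connected graph with fewer edges than the rank
requires. -/
theorem isSpanningTree_iff_of_card_eq [Fintype α] [DecidableEq β]
    (hst : ∀ e ∈ E(G), G.IsLink e (s e) (t e)) (hV : V(G) = Set.univ) (r : α) {F : Finset β}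
    (hF : (F : Set β) ⊆ E(G)) (hc : F.card = Fintype.card {v // v ≠ r}) :
    G.IsSpanningTree F ↔ ∀ x y, (G.restrict (F : Set β)).Linked x y := by
  have : Nonempty α := ⟨r⟩
  rw [isSpanningTree_iff hV]
  refine ⟨fun h => h.2.2, fun h => ⟨hF, isAcyclic_restrict_iff.2 fun e he x y hxy hl => ?_, h⟩⟩
  have hconn : ∀ a b, (G.restrict ((F.erase e : Finset β) : Set β)).Linked a b := by
    intro a b
    rw [Finset.coe_erase]
    refine (h a b).rel_of_isLink (G.restrict ((F : Set β) \ {e})).linkedSetoid ?_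
    rintro f c d ⟨hf, hcd⟩
    by_cases hfe : f = e
    · subst hfe
      obtain ⟨rfl, rfl⟩ | ⟨rfl, rfl⟩ := hxy.eq_and_eq_or_eq_and_eq hcd
      exacts [hl, hl.symm]
    · exact hcd.linked_restrict ⟨hf, hfe⟩
  have h1 := card_le_of_linked hst r hconn
  have h2 := Finset.card_erase_lt_of_mem (Finset.mem_coe.1 he)
  omega

/-- The square submatrix of the reduced incidence matrix with columns given by `f`. -/
def incidenceMinor (R : Type*) [CommRing R] (r : α) (s t : β → α) (f : {v // v ≠ r} → β) :
    Matrix {v // v ≠ r} {v // v ≠ r} R :=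
  Matrix.of fun i j => incidence R r s t (f j) i

theorem col_incidenceMinor (f : {v // v ≠ r} → β) (j : {v // v ≠ r}) :
    (incidenceMinor R r s t f).col j = incidence R r s t (f j) := rfl

theorem range_mulVec_incidenceMinor [Fintype α] (f : {v // v ≠ r} → β) :
    LinearMap.range (incidenceMinor R r s t f).mulVecLin =
      Submodule.span R (incidence R r s t '' Set.range f) := by
  rw [Matrix.range_mulVecLin, ← Set.range_comp]
  rfl

/-- Already over ℤ the columns of a connected graph span everything, so the integer minor is a unit,
hence ±1; then map ℤ to `R`. -/
theorem det_incidenceMinor_sq_of_isSpanningTree [Fintype α] [DecidableEq β]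
    (hst : ∀ e ∈ E(G), G.IsLink e (s e) (t e)) (hV : V(G) = Set.univ)
    (f : {v // v ≠ r} → β) (h : G.IsSpanningTree (Finset.univ.image f)) :
    (incidenceMinor R r s t f).det ^ 2 = 1 := by
  have : Nonempty α := ⟨r⟩
  have hL := ((isSpanningTree_iff hV).1 h).2.2
  rw [Finset.coe_image, Finset.coe_univ, Set.image_univ] at hL
  have hu : IsUnit (incidenceMinor ℤ r s t f).det := by
    rw [← Matrix.isUnit_iff_isUnit_det, ← Matrix.mulVec_surjective_iff_isUnit]
    have := range_mulVec_incidenceMinor (R := ℤ) (s := s) (t := t) f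
    rw [span_incidence_eq_top hst hL] at this
    exact LinearMap.range_eq_top.1 this
  have hmap : incidenceMinor R r s t f = (incidenceMinor ℤ r s t f).map (Int.castRingHom R) := by
    ext i j
    simp only [incidenceMinor, incidence, rootedIndicator, Matrix.of_apply, Matrix.map_apply,
      Pi.sub_apply, map_sub]
    split_ifs <;> simp
  rw [hmap, ← RingHom.mapMatrix_apply, ← RingHom.map_det, ← map_pow, Int.isUnit_sq hu, map_one]

/-- If the minor were nonzero, its columns would span, so all vertices would be linked; with this
number of edges that forces a tree. -/
theorem det_incidenceMinor_of_not_isSpanningTree [Fintype α] [DecidableEq β] {K : Type*} [Field K]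
    (hst : ∀ e ∈ E(G), G.IsLink e (s e) (t e)) (hV : V(G) = Set.univ)
    (f : {v // v ≠ r} → β) (hf : Function.Injective f) (hE : Set.range f ⊆ E(G))
    (h : ¬ G.IsSpanningTree (Finset.univ.image f)) :
    (incidenceMinor K r s t f).det = 0 := by
  have him : ((Finset.univ.image f : Finset β) : Set β) = Set.range f := by simp
  rw [isSpanningTree_iff_of_card_eq hst hV r (him ▸ hE)
    (by rw [Finset.card_image_of_injective _ hf, Finset.card_univ]), him] at h
  by_contra hne
  refine h fun x y => linked_of_rootedIndicator_sub_mem_span (R := K) (r := r) hst hE ?_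
  rw [← range_mulVec_incidenceMinor, LinearMap.range_eq_top.2]
  · trivial
  · exact Matrix.mulVec_surjective_iff_isUnit.2
      ((Matrix.isUnit_iff_isUnit_det _).2 (isUnit_iff_ne_zero.2 hne))

end Incidence

end Graph

/-! ### The matrix-tree theorem and the signed forest sum -/

namespace Graph

section SignedCount

open Matrix

variable {α β : Type*} [DecidableEq α] {G : Graph α β} {r : α}
  {s t : β → α}

/-- Exchanging the edge `p` for the edge `q` in a square submatrix of the incidence matrix. -/
theorem det_updateCol_mul_det_incidenceMinor [Fintype α] [DecidableEq β] {K : Type*} [Field K]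
    (hst : ∀ e ∈ E(G), G.IsLink e (s e) (t e)) (hV : V(G) = Set.univ) {p q : β}
    (hqE : q ∈ E(G)) (f : {v // v ≠ r} → β) (hf : Function.Injective f)
    (hE : Set.range f ⊆ E(G)) (hqf : q ∉ Set.range f) {i : {v // v ≠ r}} (hi : f i = p)
    {F : Finset β} (hF : F = (Finset.univ.image f).erase p)
    [Decidable (G.IsSeparatingForest 2 {s p, t p} {s q, t q} F)] :
    ((incidenceMinor K r s t f).updateCol i (incidence K r s t q)).det *
        (incidenceMinor K r s t f).det =
      if G.IsSeparatingForest 2 {s p, t p} {s q, t q} F then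
        (-1) ^ G.signExponent (s p) (s q) F else 0 := by
  have : Nonempty α := ⟨r⟩
  have hpE : p ∈ E(G) := hE ⟨i, hi⟩
  have hp := hst p hpE
  have hq := hst q hqE
  have hpim : p ∈ Finset.univ.image f := Finset.mem_image.2 ⟨i, Finset.mem_univ _, hi⟩
  have hpF : p ∉ F := by simp [hF]
  have hqF : q ∉ F := fun h => hqf (by
    rw [hF, Finset.mem_erase, Finset.mem_image] at h
    obtain ⟨-, j, -, hj⟩ := h
    exact ⟨j, hj⟩)
  have him : Finset.univ.image f = insert p F := by rw [hF, Finset.insert_erase hpim]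
  have hFi : f '' {i}ᶜ = (F : Set β) := by
    rw [Set.image_compl_eq_range_sdiff_image hf, hF, Finset.coe_erase, Finset.coe_image]
    simp [hi]
  have hM' : (incidenceMinor K r s t f).updateCol i (incidence K r s t q) =
      incidenceMinor K r s t (Function.update f i q) := by
    ext k j
    by_cases hj : j = i
    · subst hj; simp [incidenceMinor]
    · simp [incidenceMinor, hj]
  have hinj' : Function.Injective (Function.update f i q) := by
    intro a b hab
    by_cases ha : a = i <;> by_cases hb : b = i
    · rw [ha, hb]
    · subst ha; rw [Function.update_self, Function.update_of_ne hb] at hab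
      exact absurd ⟨b, hab.symm⟩ hqf
    · subst hb; rw [Function.update_self, Function.update_of_ne ha] at hab
      exact absurd ⟨a, hab⟩ hqf
    · rw [Function.update_of_ne ha, Function.update_of_ne hb] at hab
      exact hf hab
  have him' : Finset.univ.image (Function.update f i q) = insert q F := by
    ext x
    rw [Finset.mem_insert, ← Finset.mem_coe (s := F), ← hFi, Finset.mem_image]
    constructor
    · rintro ⟨j, -, rfl⟩
      by_cases hj : j = i
      · subst hj; simp
      · rw [Function.update_of_ne hj]
        exact Or.inr ⟨j, hj, rfl⟩
    · rintro (rfl | ⟨j, hj, rfl⟩)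
      · exact ⟨i, Finset.mem_univ _, by simp⟩
      · exact ⟨j, Finset.mem_univ _, Function.update_of_ne hj _ _⟩
  have hE' : Set.range (Function.update f i q) ⊆ E(G) := by
    rintro _ ⟨j, rfl⟩
    by_cases hj : j = i
    · subst hj; simpa using hqE
    · rw [Function.update_of_ne hj]; exact hE ⟨j, rfl⟩
  have hiff := isSeparatingForest_two_iff hV hp hq (F := F)
  by_cases h1 : G.IsSpanningTree (insert p F)
  swap
  · rw [if_neg fun h => h1 (hiff.1 h).2.2.1, det_incidenceMinor_of_not_isSpanningTree hst hV f hf hE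
      (him ▸ h1), mul_zero]
  by_cases h2 : G.IsSpanningTree (insert q F)
  swap
  · rw [if_neg fun h => h2 (hiff.1 h).2.2.2, hM', det_incidenceMinor_of_not_isSpanningTree hst hV _ hinj' hE'
      (him' ▸ h2), zero_mul]
  rw [if_pos (hiff.2 ⟨hpF, hqF, h1, h2⟩)]
  have hsq := det_incidenceMinor_sq_of_isSpanningTree (R := K) hst hV f (him ▸ h1)
  have hn2 := h2.not_linked_of_insert hV hq hqF
  have hor := h1.linked_or_linked_of_insert hV hp
  -- Modulo the columns of `F`, vertices of one tree are identified. Matching the ends of `p` with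
  -- those of `q` identifies their columns up to the sign.
  have hmem : incidence K r s t p - (-1 : K) ^ G.signExponent (s p) (s q) F • incidence K r s t q ∈
      Submodule.span K (incidence K r s t '' F) := by
    have hsub : ∀ {x y}, (G.restrict (F : Set β)).Linked x y → _ := fun h =>
      rootedIndicator_sub_mem_span (R := K) (r := r) hst h
    by_cases h : (G.restrict (F : Set β)).Linked (s p) (s q)
    · have h' : (G.restrict (F : Set β)).Linked (t p) (t q) :=
        ((hor (t q)).resolve_left fun h' => hn2 (h.symm.trans h'.symm)).symm
      have := Submodule.sub_mem _ (hsub h) (hsub h')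
      rw [signExponent, if_pos h, pow_zero, one_smul]
      convert! this using 1
      simp only [incidence]
      abel
    · have h1 := (hor (s q)).resolve_left fun h' => h h'.symm
      have h' : (G.restrict (F : Set β)).Linked (s p) (t q) :=
        ((hor (t q)).resolve_right fun h' => hn2 (h1.trans h'.symm)).symm
      have := Submodule.sub_mem _ (hsub h') (hsub h1.symm)
      rw [signExponent, if_neg h, pow_one, neg_smul, one_smul]
      convert! this using 1
      simp only [incidence]
      abel
  -- The other columns are exactly those of `F`, so this column is dependent on them; linearity in
  -- column `i` then relates the two minors.
  have hz : ((incidenceMinor K r s t f).updateCol i (incidence K r s t p -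
      (-1 : K) ^ G.signExponent (s p) (s q) F • incidence K r s t q)).det = 0 := by
    apply det_updateCol_eq_zero_of_mem_span
    rw [← hFi, ← Set.image_comp] at hmem
    exact hmem
  have hself : (incidenceMinor K r s t f).updateCol i (incidence K r s t p) =
      incidenceMinor K r s t f := by
    rw [← hi, ← col_incidenceMinor]
    exact updateCol_eq_self _ _
  have hlin : (incidenceMinor K r s t f).det = (-1 : K) ^ G.signExponent (s p) (s q) F *
      ((incidenceMinor K r s t f).updateCol i (incidence K r s t q)).det := by
    rw [← cramer_apply, map_sub, map_smul, Pi.sub_apply, Pi.smul_apply, cramer_apply,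
      cramer_apply, hself, smul_eq_mul, sub_eq_zero] at hz
    exact hz
  have hone : ((-1 : K) ^ G.signExponent (s p) (s q) F) ^ 2 = 1 := by
    rw [← pow_mul, mul_comm, pow_mul]; simp
  set ε := (-1 : K) ^ G.signExponent (s p) (s q) F
  set D := ((incidenceMinor K r s t f).updateCol i (incidence K r s t q)).det
  rw [hlin] at hsq ⊢
  have : D ^ 2 = 1 := by rw [mul_pow, hone, one_mul] at hsq; exact hsq
  linear_combination ε * this

/-- The reduced Laplacian matrix of `G` with edge weights `w`. -/
def reducedLaplacian [Fintype β] (r : α) (s t : β → α) (w : β → ℝ) :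
    Matrix {v // v ≠ r} {v // v ≠ r} ℝ :=
  ∑ e, w e • vecMulVec (incidence ℝ r s t e) (incidence ℝ r s t e)

theorem isSymm_reducedLaplacian [Fintype β] (w : β → ℝ) : (reducedLaplacian r s t w).IsSymm := by
  simp [IsSymm, reducedLaplacian, transpose_sum, transpose_vecMulVec]

open Classical in
theorem det_mul_det_submatrix_incidence [Fintype α] [DecidableEq β] (hst : ∀ e ∈ E(G), G.IsLink e (s e) (t e))
    (hV : V(G) = Set.univ) {w : β → ℝ} (hw : ∀ e, e ∉ E(G) → w e = 0) (f : {v // v ≠ r} → β)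
    (hf : Function.Injective f) :
    (of fun i j => w (f j) * incidence ℝ r s t (f j) i).det *
        (of fun j i => incidence ℝ r s t (f j) i).det =
      if G.IsSpanningTree (Finset.univ.image f) then ∏ e ∈ Finset.univ.image f, w e else 0 := by
  have h1 : (of fun i j => w (f j) * incidence ℝ r s t (f j) i).det =
      (∏ e ∈ Finset.univ.image f, w e) * (incidenceMinor ℝ r s t f).det := by
    rw [Finset.prod_image fun _ _ _ _ h => hf h]
    exact det_mul_row (fun j => w (f j)) (incidenceMinor ℝ r s t f)
  have h2 : (of fun j i => incidence ℝ r s t (f j) i).det = (incidenceMinor ℝ r s t f).det :=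
    det_transpose (incidenceMinor ℝ r s t f)
  rw [h1, h2, mul_assoc, ← pow_two]
  split_ifs with h
  · rw [det_incidenceMinor_sq_of_isSpanningTree hst hV f h, mul_one]
  · by_cases hE : Set.range f ⊆ E(G)
    · rw [det_incidenceMinor_of_not_isSpanningTree hst hV f hf hE h]
      simp
    · obtain ⟨_, ⟨j, rfl⟩, hj⟩ := Set.not_subset.1 hE
      rw [Finset.prod_eq_zero (Finset.mem_image_of_mem f (Finset.mem_univ j)) (hw _ hj), zero_mul]

open Classical in
theorem det_reducedLaplacian_eq_sum_powersetCard [Fintype α] [DecidableEq β] [Fintype β]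
    (hst : ∀ e ∈ E(G), G.IsLink e (s e) (t e))
    (hV : V(G) = Set.univ) {w : β → ℝ} (hw : ∀ e, e ∉ E(G) → w e = 0) :
    (reducedLaplacian r s t w).det =
      ∑ S ∈ Finset.univ.powersetCard (Fintype.card {v // v ≠ r}),
        if G.IsSpanningTree S then ∏ e ∈ S, w e else 0 := by
  have h : reducedLaplacian r s t w =
      (of fun i e => w e * incidence ℝ r s t e i) * of fun e i => incidence ℝ r s t e i := by
    ext i j
    simp [reducedLaplacian, mul_apply, Matrix.sum_apply, vecMulVec_apply, mul_assoc]
  rw [h]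
  exact det_mul_eq_sum_powersetCard _ _ _ fun f hf =>
    det_mul_det_submatrix_incidence hst hV hw f hf

open Classical in
/-- The weighted **matrix-tree theorem**. -/
theorem det_reducedLaplacian [Fintype α] [DecidableEq β] [Fintype β] (hst : ∀ e ∈ E(G), G.IsLink e (s e) (t e))
    (hV : V(G) = Set.univ) {w : β → ℝ} (hw : ∀ e, e ∉ E(G) → w e = 0) :
    (reducedLaplacian r s t w).det = ∑ S with G.IsSpanningTree S, ∏ e ∈ S, w e := by
  rw [det_reducedLaplacian_eq_sum_powersetCard hst hV hw, ← Finset.sum_filter]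
  refine Finset.sum_congr ?_ fun _ _ => rfl
  ext S
  simp only [Finset.mem_filter, Finset.mem_powersetCard, Finset.subset_univ, true_and,
    Finset.mem_univ, and_iff_right_iff_imp]
  exact fun h => h.card_eq hst hV r

-- The updated matrix is again a product of two incidence-type factors. In Cauchy–Binet the sets
-- without `p` reproduce the tree sum for `det L`, and the sets `F ∪ {p}` give the signed forests.
open Classical in
theorem det_reducedLaplacian_add_vecMulVec_sub_det [Fintype α] [DecidableEq β] [Fintype β]
    (hst : ∀ e ∈ E(G), G.IsLink e (s e) (t e))
    (hV : V(G) = Set.univ) {w : β → ℝ} (hw : ∀ e, e ∉ E(G) → w e = 0) {p q : β}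
    (hpq : p ≠ q) (hpE : p ∈ E(G)) (hqE : q ∈ E(G)) (hp : w p = 0) (hq : w q = 0) :
    (reducedLaplacian r s t w +
        vecMulVec (incidence ℝ r s t q) (incidence ℝ r s t p)).det -
      (reducedLaplacian r s t w).det =
      ∑ F ∈ G.separatingForests 2 {s p, t p} {s q, t q},
        (-1 : ℝ) ^ G.signExponent (s p) (s q) F * ∏ e ∈ F, w e := by
  let g : Finset β → ℝ := fun F => (-1 : ℝ) ^ G.signExponent (s p) (s q) F * ∏ e ∈ F, w e
  -- Since `w p = 0`, column `p` of the weighted factor is free to carry the unweighted column of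
  -- `q`; against row `p` of the other factor it yields the rank-one term.
  let A : Matrix {v // v ≠ r} β ℝ := of fun i e =>
    if e = p then incidence ℝ r s t q i else w e * incidence ℝ r s t e i
  have h : reducedLaplacian r s t w + vecMulVec (incidence ℝ r s t q) (incidence ℝ r s t p) =
      A * of fun e i => incidence ℝ r s t e i := by
    ext i j
    have : ∀ e, A i e * incidence ℝ r s t e j =
        (w e • vecMulVec (incidence ℝ r s t e) (incidence ℝ r s t e)) i j +
          if e = p then incidence ℝ r s t q i * incidence ℝ r s t p j else 0 := by
      intro e
      by_cases he : e = p
      · subst he; simp [A, hp]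
      · simp [A, he, vecMulVec_apply, mul_assoc]
    rw [mul_apply]
    simp only [of_apply, this, Finset.sum_add_distrib]
    simp [reducedLaplacian, Matrix.sum_apply, vecMulVec_apply]
  have hdet := det_mul_eq_sum_powersetCard A (of fun e i => incidence ℝ r s t e i)
    (fun S => (if G.IsSpanningTree S then ∏ e ∈ S, w e else 0) +
      if p ∈ S ∧ G.IsSeparatingForest 2 {s p, t p} {s q, t q} (S.erase p) then g (S.erase p)
      else 0) ?_
  · rw [h, hdet, Finset.sum_add_distrib, ← det_reducedLaplacian_eq_sum_powersetCard hst hV hw,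
      add_sub_cancel_left, ← Finset.sum_filter]
    refine Finset.sum_nbij' (fun S => S.erase p) (fun F => insert p F) ?_ ?_ ?_ ?_ ?_
    · intro S hS
      simpa [separatingForests] using (Finset.mem_filter.1 hS).2.2
    · intro F hF
      have hF' : G.IsSeparatingForest 2 {s p, t p} {s q, t q} F := by
        simpa [separatingForests] using hF
      obtain ⟨hpF, -, hT, -⟩ := (isSeparatingForest_two_iff hV (hst p hpE) (hst q hqE)).1 hF'
      refine Finset.mem_filter.2 ⟨Finset.mem_powersetCard.2 ⟨Finset.subset_univ _,
        hT.card_eq hst hV r⟩, Finset.mem_insert_self _ _, ?_⟩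
      rwa [Finset.erase_insert hpF]
    · intro S hS
      exact Finset.insert_erase (Finset.mem_filter.1 hS).2.1
    · intro F hF
      have hF' : G.IsSeparatingForest 2 {s p, t p} {s q, t q} F := by
        simpa [separatingForests] using hF
      exact Finset.erase_insert
        ((isSeparatingForest_two_iff hV (hst p hpE) (hst q hqE)).1 hF').1
    · intro S _
      rfl
  · intro f hf
    by_cases hpf : p ∈ Finset.univ.image f
    · obtain ⟨i, -, hi⟩ := Finset.mem_image.1 hpf
      have h0 : ∏ e ∈ Finset.univ.image f, w e = 0 := Finset.prod_eq_zero hpf hp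
      have hA : (A.submatrix id f).det = (∏ e ∈ (Finset.univ.image f).erase p, w e) *
          ((incidenceMinor ℝ r s t f).updateCol i (incidence ℝ r s t q)).det := by
        have hAe : A.submatrix id f = of fun k j => (if j = i then 1 else w (f j)) *
            ((incidenceMinor ℝ r s t f).updateCol i (incidence ℝ r s t q)) k j := by
          ext k j
          by_cases hj : j = i
          · subst hj; simp [A, hi]
          · have : f j ≠ p := fun h => hj (hf (h.trans hi.symm))
            simp [A, hj, this, incidenceMinor]
        rw [hAe, det_mul_row, ← hi, ← Finset.image_erase hf,
          Finset.prod_image fun _ _ _ _ h => hf h,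
          ← Finset.mul_prod_erase Finset.univ _ (Finset.mem_univ i), if_pos rfl, one_mul]
        congr 1
        exact Finset.prod_congr rfl fun j hj => if_neg (Finset.ne_of_mem_erase hj)
      have h2 : ((of fun e i => incidence ℝ r s t e i).submatrix f id).det =
          (incidenceMinor ℝ r s t f).det := det_transpose (incidenceMinor ℝ r s t f)
      simp only [h0, ite_self, zero_add, hpf, true_and, g]
      rw [hA, h2]
      -- If this product is nonzero, `f` takes only edges as values and avoids `q`, as the exchange
      -- lemma demands; otherwise both sides vanish.
      by_cases hz : ∏ e ∈ (Finset.univ.image f).erase p, w e = 0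
      · simp [hz]
      · have hz' : ∀ j, f j ≠ p → w (f j) ≠ 0 := fun j hj => Finset.prod_ne_zero_iff.1 hz _
          (Finset.mem_erase.2 ⟨hj, Finset.mem_image_of_mem f (Finset.mem_univ j)⟩)
        have hE : Set.range f ⊆ E(G) := by
          rintro _ ⟨j, rfl⟩
          by_cases hj : f j = p
          · rwa [hj]
          · by_contra hjE
            exact hz' j hj (hw _ hjE)
        have hqf : q ∉ Set.range f := by
          rintro ⟨j, rfl⟩
          exact hz' j hpq.symm hq
        rw [mul_assoc, det_updateCol_mul_det_incidenceMinor hst hV hqE f hf hE hqf hi rfl]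
        split_ifs <;> ring
    · rw [← det_mul_det_submatrix_incidence hst hV hw f hf]
      simp only [hpf, false_and, if_false, add_zero]
      congr 2
      ext i j
      have : f j ≠ p := fun h => hpf (Finset.mem_image.2 ⟨j, Finset.mem_univ _, h⟩)
      simp [A, this]

open Classical in
/-- The weighted sum over the spanning trees of `G` that contain, or avoid, the edges `p` and `q`
as prescribed by `b` and `c`, the edges `p` and `q` being counted with weight `1`. -/
noncomputable def spanningTreeSum [DecidableEq β] [Fintype β] (G : Graph α β) (w : β → ℝ) (p q : β)
    (b c : Bool) : ℝ :=
  ∑ S with G.IsSpanningTree S ∧ (p ∈ S ↔ b = true) ∧ (q ∈ S ↔ c = true), ∏ e ∈ S \ {p, q}, w e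

theorem spanningTreeSum_mul_sub_mul [Finite α] [DecidableEq β] [Fintype β] {G : Graph α β}
    (hV : V(G) = Set.univ) (w : β → ℝ) {p q : β} (hpq : p ≠ q) {u₀ u₁ v₀ v₁ : α}
    (hp : G.IsLink p u₀ u₁) (hq : G.IsLink q v₀ v₁) :
    G.spanningTreeSum w p q true true * G.spanningTreeSum w p q false false -
        G.spanningTreeSum w p q false true * G.spanningTreeSum w p q true false =
      -(∑ F ∈ G.separatingForests 2 {u₀, u₁} {v₀, v₁},
        (-1 : ℝ) ^ G.signExponent u₀ v₀ F * ∏ e ∈ F, w e) ^ 2 := by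
  classical
  have := Fintype.ofFinite α
  -- Orient all edges, with the prescribed order of ends on `p` and `q`, since the sign exponent
  -- depends on it.
  have hex : ∀ e, ∃ x : α × α, (e ∈ E(G) → G.IsLink e x.1 x.2) ∧ (e = p → x = (u₀, u₁)) ∧
      (e = q → x = (v₀, v₁)) := by
    intro e
    by_cases h1 : e = p
    · subst h1
      exact ⟨(u₀, u₁), fun _ => hp, fun _ => rfl, fun h => absurd h hpq⟩
    by_cases h2 : e = q
    · subst h2
      exact ⟨(v₀, v₁), fun _ => hq, fun h => absurd h h1, fun _ => rfl⟩
    by_cases he : e ∈ E(G)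
    · obtain ⟨x, y, hxy⟩ := exists_isLink_of_mem_edgeSet he
      exact ⟨(x, y), fun _ => hxy, fun h => absurd h h1, fun h => absurd h h2⟩
    · exact ⟨(u₀, u₀), fun h => absurd h he, fun h => absurd h h1, fun h => absurd h h2⟩
  choose st hst hstp hstq using hex
  let s : β → α := fun e => (st e).1
  let t : β → α := fun e => (st e).2
  have hsp : s p = u₀ := by simp [s, hstp p rfl]
  have htp : t p = u₁ := by simp [t, hstp p rfl]
  have hsq : s q = v₀ := by simp [s, hstq q rfl]
  have htq : t q = v₁ := by simp [t, hstq q rfl]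
  let w₀ : β → ℝ := fun e => if e ∈ E(G) ∧ e ≠ p ∧ e ≠ q then w e else 0
  let a := incidence ℝ u₀ s t p
  let b := incidence ℝ u₀ s t q
  let L := reducedLaplacian u₀ s t w₀
  -- This is the Laplacian in which `p` and `q` have weights `x` and `y`; the values at 0 and 1 give
  -- the four tree sums.
  have hdet : ∀ x y : ℝ, (L + x • vecMulVec a a + y • vecMulVec b b).det =
      ∑ S with G.IsSpanningTree S, (if p ∈ S then x else 1) * (if q ∈ S then y else 1) *
        ∏ e ∈ S \ {p, q}, w e := by
    intro x y
    let w' : β → ℝ := fun e => w₀ e + (if e = p then x else 0) + if e = q then y else 0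
    have h1 : L + x • vecMulVec a a + y • vecMulVec b b = reducedLaplacian u₀ s t w' := by
      simp [L, reducedLaplacian, w', add_smul, Finset.sum_add_distrib, ite_smul, a, b]
    rw [h1, det_reducedLaplacian hst hV]
    · refine Finset.sum_congr rfl fun S hS => ?_
      have hSE := ((Finset.mem_filter.1 hS).2).1
      have h2 : ∏ e ∈ S \ {p, q}, w' e = ∏ e ∈ S \ {p, q}, w e := by
        refine Finset.prod_congr rfl fun e he => ?_
        simp only [Finset.mem_sdiff, Finset.mem_insert, Finset.mem_singleton, not_or] at he
        simp [w', w₀, he.2.1, he.2.2, hSE he.1]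
      rw [← h2, ← Finset.prod_sdiff (Finset.inter_subset_left (s₁ := S) (s₂ := {p, q})),
        Finset.sdiff_inter_self_left, mul_comm]
      congr 1
      have h3 : w' p = x := by simp [w', w₀, hpq]
      have h4 : w' q = y := by simp [w', w₀, hpq.symm]
      by_cases h5 : p ∈ S <;> by_cases h6 : q ∈ S <;>
        simp [h5, h6, h3, h4, Finset.inter_insert_of_mem, Finset.inter_insert_of_notMem,
          Finset.inter_singleton_of_mem, Finset.inter_singleton_of_notMem, Finset.prod_pair hpq]
    · intro e he
      have h1 : e ≠ p := fun h => he (h ▸ hp.edge_mem)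
      have h2 : e ≠ q := fun h => he (h ▸ hq.edge_mem)
      simp [w', w₀, he, h1, h2]
  have hff : L.det = G.spanningTreeSum w p q false false := by
    have := hdet 0 0
    simp only [zero_smul, add_zero] at this
    rw [this, spanningTreeSum, ← Finset.filter_filter, Finset.sum_filter (p := fun S => _ ∧ _)]
    refine Finset.sum_congr rfl fun S _ => ?_
    by_cases h5 : p ∈ S <;> by_cases h6 : q ∈ S <;> simp [h5, h6]
  have htf : (L + vecMulVec a a).det =
      G.spanningTreeSum w p q false false + G.spanningTreeSum w p q true false := by
    have := hdet 1 0
    simp only [zero_smul, add_zero, one_smul] at this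
    simp only [this, spanningTreeSum, ← Finset.filter_filter (p := fun S => G.IsSpanningTree S),
      Finset.sum_filter (p := fun S => _ ∧ _), ← Finset.sum_add_distrib]
    refine Finset.sum_congr rfl fun S _ => ?_
    by_cases h5 : p ∈ S <;> by_cases h6 : q ∈ S <;> simp [h5, h6]
  have hft : (L + vecMulVec b b).det =
      G.spanningTreeSum w p q false false + G.spanningTreeSum w p q false true := by
    have := hdet 0 1
    simp only [zero_smul, add_zero, one_smul] at this
    simp only [this, spanningTreeSum, ← Finset.filter_filter (p := fun S => G.IsSpanningTree S),
      Finset.sum_filter (p := fun S => _ ∧ _), ← Finset.sum_add_distrib]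
    refine Finset.sum_congr rfl fun S _ => ?_
    by_cases h5 : p ∈ S <;> by_cases h6 : q ∈ S <;> simp [h5, h6]
  have htt : (L + vecMulVec a a + vecMulVec b b).det =
      G.spanningTreeSum w p q false false + G.spanningTreeSum w p q true false +
        G.spanningTreeSum w p q false true + G.spanningTreeSum w p q true true := by
    have := hdet 1 1
    simp only [one_smul] at this
    simp only [this, spanningTreeSum, ← Finset.filter_filter (p := fun S => G.IsSpanningTree S),
      Finset.sum_filter (p := fun S => _ ∧ _), ← Finset.sum_add_distrib]
    refine Finset.sum_congr rfl fun S _ => ?_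
    by_cases h5 : p ∈ S <;> by_cases h6 : q ∈ S <;> simp [h5, h6]
  have key := det_mul_det_sub_det_mul_det_of_isSymm
    (isSymm_reducedLaplacian (r := u₀) (s := s) (t := t) w₀) a b
  have hforest := det_reducedLaplacian_add_vecMulVec_sub_det (r := u₀) (s := s) (t := t) hst hV
    (w := w₀) (fun e he => by simp [w₀, he]) hpq hp.edge_mem hq.edge_mem (by simp [w₀])
    (by simp [w₀])
  rw [hforest] at key
  simp only [hsp, htp, hsq, htq] at key
  change (L + vecMulVec a a + vecMulVec b b).det * L.det -
    (L + vecMulVec a a).det * (L + vecMulVec b b).det = _ at key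
  rw [hff, htf, hft, htt] at key
  have hsum : ∑ F ∈ G.separatingForests 2 {u₀, u₁} {v₀, v₁},
        (-1 : ℝ) ^ G.signExponent u₀ v₀ F * ∏ e ∈ F, w₀ e =
      ∑ F ∈ G.separatingForests 2 {u₀, u₁} {v₀, v₁},
        (-1 : ℝ) ^ G.signExponent u₀ v₀ F * ∏ e ∈ F, w e := by
    refine Finset.sum_congr rfl fun F hF => ?_
    have hF' : G.IsSeparatingForest 2 {u₀, u₁} {v₀, v₁} F := by
      simpa [separatingForests] using hF
    obtain ⟨hpF, hqF, -⟩ := (isSeparatingForest_two_iff hV hp hq).1 hF'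
    congr 1
    refine Finset.prod_congr rfl fun e he => if_pos ⟨hF'.1.1 he, ?_, ?_⟩
    · exact fun h => hpF (h ▸ he)
    · exact fun h => hqF (h ▸ he)
  rw [hsum] at key
  linear_combination key

end SignedCount

end Graph

/-! ### From the weighted graph to its derived multigraph -/

namespace Graph

variable {α β : Type*} {G : Graph α β}

theorem deleteEdges_restrict (G : Graph α β) (D F : Set β) :
    (G.deleteEdges D).restrict F = G.restrict (F \ D) := by
  ext a b c
  · simp
  · simp only [deleteEdges_isLink, restrict_isLink, Set.mem_sdiff]
    tauto

theorem isSpanningTree_deleteEdges_iff [Nonempty α] (hV : V(G) = Set.univ) {D : Set β}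
    {F : Finset β} :
    (G.deleteEdges D).IsSpanningTree F ↔ G.IsSpanningTree F ∧ Disjoint (F : Set β) D := by
  rw [isSpanningTree_iff (by simpa using hV), isSpanningTree_iff hV, edgeSet_deleteEdges,
    Set.subset_sdiff, deleteEdges_restrict]
  constructor
  · rintro ⟨⟨h1, h2⟩, h3, h4⟩
    rw [h2.sdiff_eq_left] at h3 h4
    exact ⟨⟨h1, h3, h4⟩, h2⟩
  · rintro ⟨⟨h1, h3, h4⟩, h2⟩
    rw [h2.sdiff_eq_left]
    exact ⟨⟨h1, h2⟩, h3, h4⟩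

end Graph

namespace WeightedGraph

open scoped Graph

variable {V : Type*} {Γ : WeightedGraph V} {R : ℕ} {e : Fin R ≃ Γ.RedEdge} {w : Wildcard R}

theorem vertexSet_toGraph : V(Γ.toGraph) = Set.univ := rfl

theorem vertexSet_derived : V(Γ.derived e w) = Set.univ :=
  Graph.vertexSet_contract (by simp [vertexSet_toGraph]) _

theorem mem_edgeSet_toGraph {x : Sym2 V} : x ∈ E(Γ.toGraph) ↔ Γ.edgeWeight x ≠ 0 := by
  induction x with
  | _ i j => rfl

theorem mem_edgeSet_derived {x : Sym2 V} : x ∈ E(Γ.derived e w) ↔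
    Γ.edgeWeight x ≠ 0 ∧ x ∉ Γ.digitEdges e w false ∧ x ∉ Γ.digitEdges e w true := by
  rw [← mem_edgeSet_toGraph, ← and_assoc]
  rfl

theorem mem_digitEdges_iff {k : Fin R} (h₁ : k ≠ w.fst) (h₂ : k ≠ w.snd) {d : Bool} :
    (e k).1 ∈ Γ.digitEdges e w d ↔ w.digit ⟨k, h₁, h₂⟩ = d := by
  constructor
  · rintro ⟨l, hl, hx⟩
    rw [← hl]
    congr 1
    exact Subtype.ext (e.injective (Subtype.ext hx)).symm
  · exact fun h => ⟨_, h, rfl⟩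

theorem fst_notMem_digitEdges (d : Bool) : (e w.fst).1 ∉ Γ.digitEdges e w d := by
  rintro ⟨l, -, hx⟩
  exact l.2.1 (e.injective (Subtype.ext hx))

theorem snd_notMem_digitEdges (d : Bool) : (e w.snd).1 ∉ Γ.digitEdges e w d := by
  rintro ⟨l, -, hx⟩
  exact l.2.2 (e.injective (Subtype.ext hx))

theorem disjoint_digitEdges : Disjoint (Γ.digitEdges e w true) (Γ.digitEdges e w false) := by
  rw [Set.disjoint_left]
  rintro _ ⟨l, hl, rfl⟩ h
  rw [mem_digitEdges_iff l.2.1 l.2.2] at h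
  exact Bool.noConfusion (hl.symm.trans h)

/-- Every red edge other than the two wildcard ones carries a digit, so it has been deleted or
contracted. -/
theorem edgeWeight_pos_of_mem_derived {x : Sym2 V} (hx : x ∈ E(Γ.derived e w))
    (hp : x ≠ (e w.fst).1) (hq : x ≠ (e w.snd).1) : 0 < Γ.edgeWeight x := by
  obtain ⟨h0, h1, h2⟩ := mem_edgeSet_derived.1 hx
  refine (lt_or_gt_of_ne h0).resolve_left fun hneg => ?_
  obtain ⟨k, hk⟩ := e.surjective ⟨x, hneg⟩
  have hkx : (e k).1 = x := by rw [hk]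
  have hk1 : k ≠ w.fst := fun h => hp (by rw [← hkx, h])
  have hk2 : k ≠ w.snd := fun h => hq (by rw [← hkx, h])
  rw [← hkx, mem_digitEdges_iff hk1 hk2] at h1 h2
  cases h : w.digit ⟨k, hk1, hk2⟩ <;> simp [h] at h1 h2

theorem fst_ne_snd : (e w.fst).1 ≠ (e w.snd).1 := fun h =>
  w.lt.ne (e.injective (Subtype.ext h))

theorem forall_mem_iff_fill {T : Set (Sym2 V)} {a b : Bool} :
    (∀ k, (e k).1 ∈ T ↔ w.fill a b k = true) ↔
      ((e w.fst).1 ∈ T ↔ a = true) ∧ ((e w.snd).1 ∈ T ↔ b = true) ∧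
        Γ.digitEdges e w true ⊆ T ∧ Disjoint T (Γ.digitEdges e w false) := by
  have hfill : ∀ k (h₁ : k ≠ w.fst) (h₂ : k ≠ w.snd), w.fill a b k = w.digit ⟨k, h₁, h₂⟩ :=
    fun k h₁ h₂ => by simp [Wildcard.fill, h₁, h₂]
  constructor
  · intro h
    refine ⟨by simpa [Wildcard.fill] using h w.fst,
      by simpa [Wildcard.fill, w.lt.ne'] using h w.snd, ?_, ?_⟩
    · rintro _ ⟨l, hl, rfl⟩
      rw [h, hfill _ l.2.1 l.2.2, ← hl]
    · rw [Set.disjoint_right]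
      rintro _ ⟨l, hl, rfl⟩ hm
      rw [h, hfill _ l.2.1 l.2.2] at hm
      exact Bool.noConfusion (hl.symm.trans hm)
  · rintro ⟨h1, h2, h3, h4⟩ k
    by_cases hk1 : k = w.fst
    · subst hk1; simpa [Wildcard.fill] using h1
    by_cases hk2 : k = w.snd
    · subst hk2; simpa [Wildcard.fill, w.lt.ne'] using h2
    rw [hfill k hk1 hk2]
    cases h : w.digit ⟨k, hk1, hk2⟩
    · simpa using Set.disjoint_right.1 h4 ((mem_digitEdges_iff hk1 hk2).2 h)
    · simpa using h3 ((mem_digitEdges_iff hk1 hk2).2 h)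

variable [Fintype V]

/-- A tree in the sum would contain all digit-1 edges, which would then be acyclic. -/
theorem coeff_eq_zero (h : ¬ (Γ.toGraph.restrict (Γ.digitEdges e w true)).IsAcyclic)
    (a b : Bool) : Γ.coeff e (w.fill a b) = 0 := by
  classical
  refine Finset.sum_eq_zero fun T hT => absurd ?_ h
  obtain ⟨hT, hk⟩ := (Finset.mem_filter.1 hT).2
  exact hT.2.1.restrict_mono (forall_mem_iff_fill (T := (T : Set (Sym2 V))).1 hk).2.2.1

-- Removing the contracted edges `C` from a tree is inverse to adding them back; the remaining edges
-- other than the two wildcard ones are exactly its black edges.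
open Classical in
theorem coeff_eq_spanningTreeSum
    (h : (Γ.toGraph.restrict (Γ.digitEdges e w true)).IsAcyclic) (a b : Bool) :
    Γ.coeff e (w.fill a b) =
      (Γ.derived e w).spanningTreeSum Γ.edgeWeight (e w.fst).1 (e w.snd).1 a b := by
  classical
  have : Nonempty V := by
    obtain ⟨i, -⟩ := Quot.exists_rep (e w.fst).1
    exact ⟨i.1⟩
  let C : Finset (Sym2 V) := (Γ.digitEdges e w true).toFinset
  have hC : (C : Set (Sym2 V)) = Γ.digitEdges e w true := Set.coe_toFinset _
  have hmemC : ∀ {x}, x ∈ C ↔ x ∈ Γ.digitEdges e w true := Set.mem_toFinset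
  have hCE : (C : Set (Sym2 V)) ⊆ E(Γ.toGraph.deleteEdges (Γ.digitEdges e w false)) := by
    rw [hC, Graph.edgeSet_deleteEdges, Set.subset_sdiff]
    refine ⟨?_, disjoint_digitEdges⟩
    rintro _ ⟨l, -, rfl⟩
    exact mem_edgeSet_toGraph.2 (e l.1).2.ne
  have hCA : ((Γ.toGraph.deleteEdges (Γ.digitEdges e w false)).restrict
      (C : Set (Sym2 V))).IsAcyclic := by
    rw [Graph.deleteEdges_restrict, hC, disjoint_digitEdges.sdiff_eq_left]
    exact h
  have htree : ∀ S : Finset (Sym2 V), Disjoint S C → ((Γ.derived e w).IsSpanningTree S ↔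
      Γ.toGraph.IsSpanningTree (C ∪ S) ∧
        Disjoint ((C ∪ S : Finset (Sym2 V)) : Set (Sym2 V)) (Γ.digitEdges e w false)) := by
    intro S hS
    rw [← Graph.isSpanningTree_deleteEdges_iff vertexSet_toGraph,
      ← Graph.isSpanningTree_contract_iff (by simp [vertexSet_toGraph]) hS hCE hCA, derived, hC]
  have hpC : (e w.fst).1 ∉ C := fun h => fst_notMem_digitEdges _ (hmemC.1 h)
  have hqC : (e w.snd).1 ∉ C := fun h => snd_notMem_digitEdges _ (hmemC.1 h)
  have hdisj : ∀ S : Finset (Sym2 V), (Γ.derived e w).IsSpanningTree S → Disjoint S C := by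
    intro S hS
    rw [Finset.disjoint_left]
    exact fun x hx hxC => (mem_edgeSet_derived.1 (hS.1 hx)).2.2 (hmemC.1 hxC)
  rw [coeff, Graph.spanningTreeSum]
  refine Finset.sum_bij' (fun T _ => T \ C) (fun S _ => C ∪ S) ?_ ?_ ?_ ?_ ?_
  · intro T hT
    obtain ⟨hT, hk⟩ := (Finset.mem_filter.1 hT).2
    obtain ⟨h1, h2, h3, h4⟩ := (forall_mem_iff_fill (T := (T : Set (Sym2 V)))).1 hk
    have hCT : C ⊆ T := fun x hx => h3 (hmemC.1 hx)
    refine Finset.mem_filter.2 ⟨Finset.mem_univ _, ?_, ?_, ?_⟩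
    · rw [htree _ Finset.sdiff_disjoint, Finset.union_sdiff_of_subset hCT]
      exact ⟨hT, h4⟩
    · simpa [hpC] using h1
    · simpa [hqC] using h2
  · intro S hS
    obtain ⟨hS, h1, h2⟩ := (Finset.mem_filter.1 hS).2
    obtain ⟨h3, h4⟩ := (htree S (hdisj S hS)).1 hS
    refine Finset.mem_filter.2 ⟨Finset.mem_univ _, h3,
      (forall_mem_iff_fill (T := ((C ∪ S : Finset (Sym2 V)) : Set (Sym2 V)))).2
        ⟨by simpa [hpC] using h1, by simpa [hqC] using h2, ?_, h4⟩⟩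
    rw [Finset.coe_union, hC]
    exact Set.subset_union_left
  · intro T hT
    have h3 := ((forall_mem_iff_fill (T := (T : Set (Sym2 V)))).1
      (Finset.mem_filter.1 hT).2.2).2.2.1
    exact Finset.union_sdiff_of_subset fun x hx => h3 (hmemC.1 hx)
  · intro S hS
    exact Finset.union_sdiff_cancel_left (hdisj S (Finset.mem_filter.1 hS).2.1).symm
  · intro T hT
    obtain ⟨hT, hk⟩ := (Finset.mem_filter.1 hT).2
    have h4 := ((forall_mem_iff_fill (T := (T : Set (Sym2 V)))).1 hk).2.2.2
    refine Finset.prod_congr ?_ fun _ _ => rfl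
    ext x
    simp only [Finset.mem_filter, Finset.mem_sdiff, Finset.mem_insert, Finset.mem_singleton, not_or]
    constructor
    · rintro ⟨hx, hpos⟩
      refine ⟨⟨hx, fun hxC => ?_⟩, ?_, ?_⟩
      · obtain ⟨l, -, rfl⟩ := hmemC.1 hxC
        exact (e l.1).2.not_gt hpos
      · rintro rfl; exact (e w.fst).2.not_gt hpos
      · rintro rfl; exact (e w.snd).2.not_gt hpos
    · rintro ⟨⟨hx, hxC⟩, hp, hq⟩
      exact ⟨hx, edgeWeight_pos_of_mem_derived (mem_edgeSet_derived.2
        ⟨mem_edgeSet_toGraph.1 (hT.1 hx), Set.disjoint_left.1 h4 hx,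
          fun h => hxC (hmemC.2 h)⟩) hp hq⟩

end WeightedGraph

open Classical in
theorem mainTheorem12 {V : Type*} [Fintype V] (Γ : WeightedGraph V) {R : ℕ}
    (e : Fin R ≃ Γ.RedEdge) (w : Wildcard R) :
    ((Γ.toGraph.restrict (Γ.digitEdges e w true)).IsAcyclic →
      ∀ u₀ u₁ v₀ v₁,
        (Γ.derived e w).IsLink (e w.fst).1 u₀ u₁ →
        (Γ.derived e w).IsLink (e w.snd).1 v₀ v₁ →
        Γ.discr e w =
          -((∑ F ∈ (Γ.derived e w).separatingForests 2 {u₀, u₁} {v₀, v₁},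
              (-1 : ℝ) ^ (Γ.derived e w).signExponent u₀ v₀ F *
                ∏ x ∈ F, Γ.edgeWeight x) ^ 2) ∧
        ((∀ i j, 0 < Γ.weight i j → Γ.weight i j = 1) →
          Γ.discr e w =
            -(((∑ F ∈ (Γ.derived e w).separatingForests 2 {u₀, u₁} {v₀, v₁},
              (-1 : ℤ) ^ (Γ.derived e w).signExponent u₀ v₀ F : ℤ) : ℝ) ^ 2))) ∧
    (¬ (Γ.toGraph.restrict (Γ.digitEdges e w true)).IsAcyclic → Γ.discr e w = 0) := by
  refine ⟨fun hA u₀ u₁ v₀ v₁ hp hq => ?_, fun hA => ?_⟩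
  · have main : Γ.discr e w =
        -((∑ F ∈ (Γ.derived e w).separatingForests 2 {u₀, u₁} {v₀, v₁},
          (-1 : ℝ) ^ (Γ.derived e w).signExponent u₀ v₀ F * ∏ x ∈ F, Γ.edgeWeight x) ^ 2) := by
      rw [WeightedGraph.discr]
      simp only [WeightedGraph.coeff_eq_spanningTreeSum hA]
      exact Graph.spanningTreeSum_mul_sub_mul WeightedGraph.vertexSet_derived Γ.edgeWeight
        WeightedGraph.fst_ne_snd hp hq
    refine ⟨main, fun hone => ?_⟩
    rw [main]
    congr 2
    push_cast
    refine Finset.sum_congr rfl fun F hF => ?_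
    have hF' : (Γ.derived e w).IsSeparatingForest 2 {u₀, u₁} {v₀, v₁} F := by
      simpa [Graph.separatingForests] using hF
    obtain ⟨hpF, hqF, -⟩ :=
      (Graph.isSeparatingForest_two_iff WeightedGraph.vertexSet_derived hp hq).1 hF'
    -- A separating forest avoids both wildcard edges, so all its edges are black.
    rw [Finset.prod_eq_one, mul_one]
    intro x hx
    have hpos := WeightedGraph.edgeWeight_pos_of_mem_derived (hF'.1.1 hx)
      (fun h => hpF (h ▸ hx)) fun h => hqF (h ▸ hx)
    induction x with
    | _ i j => exact hone i j hpos
  · simp [WeightedGraph.discr, WeightedGraph.coeff_eq_zero hA]
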